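/- Let $(X,\mathfrak A,\mu)$ be a $\sigma$-finite measure space, and let $L^0(X,\mu)$ be the space of real-valued measurable functions modulo $\mu$-a.e. equality, with the topology of local convergence in measure (induced by the metric $d(f,g)=\int_X (|f-g|\wedge 1)\,\varphi\,d\mu$ for any integrable $\varphi\colon X\to(0,\infty)$). Let $q\colon L^2(X,\mu)\to[0,\infty]$ be a quadratic form on the real space $L^2(X,\mu)$, i.e. $q(cf)=c^2q(f)$ for $c\in\mathbb R$ (with $0\cdot\infty=0$) and $q(f+g)+q(f-g)=2q(f)+2q(g)$, with domain $D(q)=\{f : q(f)<\infty\}$. Assume that $q$ is closed, i.e. $D(q)$ is complete with respect to the metric $d_q(f,g)=q(f-g)^{1/2}+\|f-g\|_2$, and that $q$ satisfies the first Beurling–Deny criterion, i.e. $q(|f|)\le q(f)$ for all $f\in L^2(X,\mu)$. Let $q_e\colon L^0(X,\mu)\to[0,\infty]$ be the extended form of $q$ (its closure on $L^0(X,\mu)$): $q_e(f)=\lim_{n\to\infty} q(f_n)$ if there is a sequence $(f_n)$ in $D(q)$ with $q(f_n-f_m)\to 0$ as $n,m\to\infty$ and $f_n\to f$ in $L^0(X,\mu)$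 (the limit then does not depend on the choice of the sequence), and $q_e(f)=\infty$ otherwise. Let $D(q_e)=\{f\in L^0(X,\mu) : q_e(f)<\infty\}$ and, for $f,g\in D(q_e)$, let $q_e(f,g)=\tfrac14\bigl(q_e(f+g)-q_e(f-g)\bigr)$. **Proposition (Abstract Hardy inequality).** Let $h\in D(q_e)$ be nonnegative and let $f\in D(q_e)$ be such that $hf\in D(q_e)$ and $hf^2\in D(q_e)$. Then $$q_e(hf)\ \ge\ q_e(hf^2,h).$$ -/

import Mathlib

open MeasureTheory Filter Topology
open scoped ENNReal

/-- A quadratic form with values in `[0, ∞]` on a real vector space: it is homogeneous of degree two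
(with the convention `0 * ∞ = 0`, so that `q 0 = 0`) and satisfies the parallelogram identity. -/
structure IsQuadForm {V : Type*} [AddCommGroup V] [Module ℝ V] (q : V → ℝ≥0∞) : Prop where
  smul : ∀ (c : ℝ) (f : V), q (c • f) = ENNReal.ofReal (c ^ 2) * q f
  parallelogram : ∀ f g : V, q (f + g) + q (f - g) = 2 * q f + 2 * q g

/-- The domain `D(q)` of a form: the elements on which it is finite. -/
def formDomain {V : Type*} (q : V → ℝ≥0∞) : Set V :=
  {f | q f < ∞}

/-- The bilinear form induced by `q` on its domain, by polarization. It is only meaningful for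
`f, g ∈ formDomain q`, where `q (f + g)` and `q (f - g)` are finite. -/
noncomputable def polarForm {V : Type*} [AddCommGroup V] (q : V → ℝ≥0∞) (f g : V) : ℝ :=
  ((q (f + g)).toReal - (q (f - g)).toReal) / 4

/-- `q`-Cauchy sequences: sequences in `D(q)` with `q (u m - u n) → 0` as `m, n → ∞`. -/
def IsFormCauchy {V : Type*} [AddCommGroup V] (q : V → ℝ≥0∞) (u : ℕ → V) : Prop :=
  (∀ n, u n ∈ formDomain q) ∧
    ∀ ε : ℝ≥0∞, 0 < ε → ∃ N : ℕ, ∀ m ≥ N, ∀ n ≥ N, q (u m - u n) < ε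

/-- A form on a normed space is closed if its domain is complete with respect to the metric
`d_q(f, g) = q(f - g)^{1/2} + ‖f - g‖`. A sequence is Cauchy (convergent) for `d_q` if and only if
it is so both for `q` and for the norm. -/
def IsClosedForm {V : Type*} [NormedAddCommGroup V] (q : V → ℝ≥0∞) : Prop :=
  ∀ u : ℕ → V, IsFormCauchy q u → CauchySeq u →
    ∃ f ∈ formDomain q,
      Tendsto (fun n => q (u n - f)) atTop (𝓝 0) ∧ Tendsto u atTop (𝓝 f)

/-- The first Beurling-Deny criterion for a form on `L²(X, μ)`. -/
def FirstBeurlingDeny {X : Type*} [MeasurableSpace X] {μ : Measure X}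
    (q : Lp ℝ 2 μ → ℝ≥0∞) : Prop :=
  ∀ f : Lp ℝ 2 μ, q |f| ≤ q f

/-- The `F`-norm `∫ (|f| ∧ 1) φ dμ` on `L⁰(X, μ)`, the space of real-valued measurable functions
modulo `μ`-a.e. equality. -/
noncomputable def fNorm {X : Type*} [MeasurableSpace X] {μ : Measure X} (φ : X → ℝ)
    (f : X →ₘ[μ] ℝ) : ℝ :=
  ∫ x, min |f x| 1 * φ x ∂μ

/-- Convergence of sequences in `L⁰(X, μ)` with respect to local convergence in measure, i.e. with
respect to the `F`-norm of a strictly positive integrable weight `φ`. On a `σ`-finite space such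
weights exist, and they all induce the same convergence; requiring it for all of them avoids the
choice of one. -/
def TendstoL0 {X : Type*} [MeasurableSpace X] {μ : Measure X} (u : ℕ → X →ₘ[μ] ℝ)
    (f : X →ₘ[μ] ℝ) : Prop :=
  ∀ φ : X → ℝ, Measurable φ → (∀ x, 0 < φ x) → Integrable φ μ →
    Tendsto (fun n => fNorm φ (u n - f)) atTop (𝓝 0)

/-- The extended form `q_e` of a form `q` on `L²(X, μ)`, i.e. the closure of `q` on `L⁰(X, μ)`:
`q_e(f) = lim q(u n)` if there is a `q`-Cauchy sequence `u` in `D(q) ⊆ L²(X, μ)` that converges to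
`f` in `L⁰(X, μ)`, and `q_e(f) = ∞` otherwise (the infimum of the empty set).
For a `q`-Cauchy sequence `lim q(u n)` exists, so that it is the `liminf`; for a closed form with
the first Beurling-Deny criterion it does not depend on the sequence, so that the infimum is
over a set with at most one element. -/
noncomputable def extendedForm {X : Type*} [MeasurableSpace X] {μ : Measure X}
    (q : Lp ℝ 2 μ → ℝ≥0∞) (f : X →ₘ[μ] ℝ) : ℝ≥0∞ :=
  sInf {c : ℝ≥0∞ | ∃ u : ℕ → Lp ℝ 2 μ, IsFormCauchy q u ∧
    TendstoL0 (fun n => (u n : X →ₘ[μ] ℝ)) f ∧ c = liminf (fun n => q (u n)) atTop}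

/-! ### Polarization of quadratic forms -/

section JordanVonNeumann

variable {V : Type*} [AddCommGroup V] [Module ℝ V]

/-! Let `G` be a symmetric positivity preserving operator on `L²` and `a ≥ 0`. For every real `t`,
the function `G(a(F - t)²) = G(aF²) - 2t G(aF) + t² Ga` is nonnegative. Setting `t = F(x)`,
multiplying by `a(x)` and integrating gives, by symmetry, `⟪aF, G(aF)⟫ ≤ ⟪a, G(aF²)⟫`
(`IsResolventSolution.inner_le_inner`).

The resolvents `G = α(L + α)⁻¹` of a lower semicontinuous form `B` with the first Beurling-Deny
property are such operators. Since `B(Gu, w) = α⟪u - Gu, w⟫` and `⟪aF, aF⟫ = ⟪aF², a⟫`, it follows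
that `B(G(aF²), a) ≤ B(G(aF), aF) ≤ B(aF, aF)`, and for suitable `α` the left side is arbitrarily
close to `B(aF², a)` (`bilinForm_le_of_mul_sq`).

The functions `h`, `hf`, `hf²` need not lie in `L²`. However, `q_e` is itself a quadratic form,
lower semicontinuous under a.e. convergence and not increased by absolute values. After division by
a common weight `ψ > 0` (`exists_pos_weight_L2`) the three functions are square integrable, and `u ↦
q_e(ψu)` is a form on `L²` with all the required properties. -/

/-- The Jordan-von Neumann theorem for nonnegative real quadratic forms: polarization is bilinear. -/
theorem exists_bilinForm_of_parallelogram (Q : V → ℝ) (hQ : ∀ x, 0 ≤ Q x)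
    (hsmul : ∀ (c : ℝ) x, Q (c • x) = c ^ 2 * Q x)
    (hpar : ∀ x y, Q (x + y) + Q (x - y) = 2 * Q x + 2 * Q y) :
    ∃ B : LinearMap.BilinForm ℝ V, ∀ x y, B x y = (Q (x + y) - Q (x - y)) / 4 := by
  let b : V → V → ℝ := fun x y => (Q (x + y) - Q (x - y)) / 4
  have hneg : ∀ x, Q (-x) = Q x := fun x => by simpa using hsmul (-1) x
  have hsymm : ∀ x y, b x y = b y x := fun x y => by
    simp only [b]
    rw [add_comm x y, ← neg_sub y x, hneg]
  have hzero : ∀ z, b 0 z = 0 := fun z => by simp [b, hneg]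
  have hmid : ∀ x y z, b (x + y) z + b (x - y) z = 2 * b x z := fun x y z => by
    have h1 := hpar (x + z) y
    have h2 := hpar (x - z) y
    simp only [b]
    rw [show x + y + z = x + z + y by abel, show x + y - z = x - z + y by abel,
      show x - y + z = x + z - y by abel, show x - y - z = x - z - y by abel]
    linarith
  have hadd : ∀ x y z, b (x + y) z = b x z + b y z := fun x y z => by
    have h1 := hmid ((1 / 2 : ℝ) • (x + y)) ((1 / 2 : ℝ) • (x + y)) z
    have h2 := hmid ((1 / 2 : ℝ) • (x + y)) ((1 / 2 : ℝ) • (x - y)) z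
    rw [sub_self, hzero] at h1
    rw [show (1 / 2 : ℝ) • (x + y) + (1 / 2 : ℝ) • (x + y) = x + y by module] at h1
    rw [show (1 / 2 : ℝ) • (x + y) + (1 / 2 : ℝ) • (x - y) = x by module,
      show (1 / 2 : ℝ) • (x + y) - (1 / 2 : ℝ) • (x - y) = y by module] at h2
    linarith
  have hhom : ∀ (c : ℝ) x z, b (c • x) z = c * b x z := fun c x z => by
    -- An additive function of the scalar that is bounded near `0` is continuous, hence real linear;
    -- the parallelogram identity supplies the bound on `[-1, 1]`.
    let φ : ℝ →+ ℝ :=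
      { toFun := fun c => b (c • x) z
        map_zero' := by simp [hzero]
        map_add' := fun s t => by rw [add_smul, hadd] }
    have hbound : Bornology.IsBounded (φ '' Set.Icc (-1) 1) := by
      rw [isBounded_iff_forall_norm_le]
      refine ⟨Q x + Q z, ?_⟩
      rintro _ ⟨t, ht, rfl⟩
      have h1 := hpar (t • x) z
      have h2 := hQ (t • x + z)
      have h3 := hQ (t • x - z)
      have h4 : t ^ 2 * Q x ≤ 1 * Q x :=
        mul_le_mul_of_nonneg_right (by nlinarith [ht.1, ht.2]) (hQ x)
      rw [hsmul] at h1
      change |(Q (t • x + z) - Q (t • x - z)) / 4| ≤ _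
      rw [abs_le]
      have := hQ x
      have := hQ z
      constructor <;> linarith
    have hcont : Continuous φ := φ.continuous_of_isBounded_nhds_zero
      (Icc_mem_nhds (by norm_num) (by norm_num)) hbound
    have := map_real_smul φ hcont c 1
    simpa [φ] using this
  exact ⟨LinearMap.mk₂ ℝ b hadd hhom
    (fun x y z => by rw [hsymm, hadd, hsymm y, hsymm z])
    (fun c x y => by rw [hsymm, hhom, hsymm y, smul_eq_mul]), fun x y => rfl⟩

/-- The domain of a quadratic form as a subspace. -/
def IsQuadForm.domain {q : V → ℝ≥0∞} (hq : IsQuadForm q) : Submodule ℝ V where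
  carrier := formDomain q
  zero_mem' := by simpa [formDomain] using (hq.smul 0 0).trans_lt (by simp)
  add_mem' := fun {x y} hx hy =>
    (le_self_add.trans_eq (hq.parallelogram x y)).trans_lt
      (ENNReal.add_lt_top.2 ⟨ENNReal.mul_lt_top (by simp) hx, ENNReal.mul_lt_top (by simp) hy⟩)
  smul_mem' := fun c x hx => (hq.smul c x).trans_lt (ENNReal.mul_lt_top (by simp) hx)

theorem IsQuadForm.mem_domain {q : V → ℝ≥0∞} (hq : IsQuadForm q) {x : V} :
    x ∈ hq.domain ↔ q x < ∞ := Iff.rfl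

theorem IsQuadForm.exists_bilinForm {q : V → ℝ≥0∞} (hq : IsQuadForm q) :
    ∃ B : LinearMap.BilinForm ℝ hq.domain, (∀ x y, B x y = polarForm q (x : V) y) ∧
      (∀ x y, B x y = B y x) ∧ ∀ x, B x x = (q x).toReal := by
  have hfin : ∀ x : hq.domain, q x ≠ ∞ := fun x => x.2.ne
  have hsmul : ∀ (c : ℝ) (x : hq.domain),
      (q (c • x : hq.domain)).toReal = c ^ 2 * (q x).toReal := fun c x => by
    rw [Submodule.coe_smul, hq.smul, ENNReal.toReal_mul, ENNReal.toReal_ofReal (sq_nonneg c)]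
  obtain ⟨B, hB⟩ := exists_bilinForm_of_parallelogram (fun x : hq.domain => (q x).toReal)
    (fun x => ENNReal.toReal_nonneg) hsmul
    (fun x y => by
      have : (q (x + y : hq.domain) + q (x - y : hq.domain)).toReal = (2 * q x + 2 * q y).toReal :=
        congrArg ENNReal.toReal (hq.parallelogram (x : V) y)
      rw [ENNReal.toReal_add (hfin (x + y)) (hfin (x - y)),
        ENNReal.toReal_add (ENNReal.mul_ne_top (by simp) (hfin x))
          (ENNReal.mul_ne_top (by simp) (hfin y))] at this
      simpa using this)
  refine ⟨B, hB, fun x y => ?_, fun x => ?_⟩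
  · have := hsmul (-1) (x - y)
    rw [hB, hB, add_comm x y]
    rw [show (-1 : ℝ) • (x - y) = y - x by module] at this
    rw [this]
    ring
  · have := hsmul 2 x
    have h0 := hsmul 0 x
    rw [show (2 : ℝ) • x = x + x by module] at this
    rw [zero_smul] at h0
    rw [hB, this, sub_self, h0]
    ring

end JordanVonNeumann

/-! ### Resolvents of lower semicontinuous forms -/

section Resolvent

variable {H : Type*} [NormedAddCommGroup H] [InnerProductSpace ℝ H] {D : Submodule ℝ H}

/-- Lower semicontinuity of the form `B`, seen as `∞` outside `D`. -/
def IsLscForm (B : LinearMap.BilinForm ℝ D) : Prop :=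
  ∀ (u : ℕ → D) (x : H) (C : ℝ), Tendsto (fun n => (u n : H)) atTop (𝓝 x) →
    (∀ n, B (u n) (u n) ≤ C) → ∃ hx : x ∈ D, B ⟨x, hx⟩ ⟨x, hx⟩ ≤ C

/-- `v` solves the resolvent equation `B(v, ·) = α ⟪u - v, ·⟫`, that is `v = α (L + α)⁻¹ u` for the
operator `L` of the form `B`. -/
def IsResolventSolution (B : LinearMap.BilinForm ℝ D) (α : ℝ) (u : H) (v : D) : Prop :=
  ∀ w : D, B v w = α * inner ℝ (u - v) (w : H)

theorem eq_zero_of_forall_quadratic_nonneg {a b : ℝ} (h : ∀ s : ℝ, 0 ≤ 2 * s * a + s ^ 2 * b) :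
    a = 0 := by
  have := discrim_le_zero (a := b) (b := 2 * a) (c := 0) (fun s => by nlinarith [h s])
  simp only [discrim] at this
  nlinarith [sq_nonneg a]

variable {B : LinearMap.BilinForm ℝ D}

theorem cauchySchwarz_bilinForm (hsymm : ∀ x y, B x y = B y x) (hnn : ∀ x, 0 ≤ B x x) (x y : D) :
    B x y ^ 2 ≤ B x x * B y y := by
  have := discrim_le_zero (a := B y y) (b := 2 * B x y) (c := B x x) (fun s => by
    have := hnn (x + s • y)
    simp only [map_add, LinearMap.add_apply, map_smul, LinearMap.smul_apply, smul_eq_mul,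
      hsymm y x] at this
    linarith)
  simp only [discrim] at this
  linarith

/-- The resolvent equation is the Euler-Lagrange equation of `w ↦ B(w, w) + α‖w - u‖²`: the first
variation at a minimizer vanishes in each direction `w`. -/
theorem isResolventSolution_of_forall_le (hsymm : ∀ x y, B x y = B y x) {α : ℝ} {u : H} {v : D}
    (hv : ∀ w : D, B v v + α * ‖(v : H) - u‖ ^ 2 ≤ B w w + α * ‖(w : H) - u‖ ^ 2) :
    IsResolventSolution B α u v := fun w => by
  have key : B v w - α * inner ℝ (u - v) (w : H) = 0 := by
    refine eq_zero_of_forall_quadratic_nonneg (b := B w w + α * ‖(w : H)‖ ^ 2) fun s => ?_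
    have h1 := hv (v + s • w)
    have h2 : ‖((v + s • w : D) : H) - u‖ ^ 2 =
        ‖(v : H) - u‖ ^ 2 - 2 * s * inner ℝ (u - v) (w : H) + s ^ 2 * ‖(w : H)‖ ^ 2 := by
      rw [show ((v + s • w : D) : H) - u = s • (w : H) - (u - v) by
        rw [Submodule.coe_add, Submodule.coe_smul]; abel, norm_sub_sq_real, norm_smul,
        inner_smul_left, real_inner_comm, norm_sub_rev u]
      simp [mul_pow]
      ring
    rw [h2] at h1
    simp only [map_add, LinearMap.add_apply, map_smul, LinearMap.smul_apply, smul_eq_mul,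
      hsymm w v] at h1
    linarith
  linarith

/-- Direct method: a minimizing sequence is Cauchy in `H` by the parallelogram law, and lower
semicontinuity puts its limit in `D` and makes it a minimizer. -/
theorem exists_isResolventSolution [CompleteSpace H] (hsymm : ∀ x y, B x y = B y x)
    (hnn : ∀ x, 0 ≤ B x x) (hlsc : IsLscForm B) {α : ℝ} (hα : 0 < α) (u : H) :
    ∃ v, IsResolventSolution B α u v := by
  let F : D → ℝ := fun v => B v v + α * ‖(v : H) - u‖ ^ 2
  have hF : ∀ v, 0 ≤ F v := fun v => add_nonneg (hnn v) (by positivity)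
  have hbdd : BddBelow (Set.range F) := ⟨0, by rintro _ ⟨v, rfl⟩; exact hF v⟩
  let I := ⨅ v, F v
  have hI : ∀ v, I ≤ F v := fun v => ciInf_le hbdd v
  have hex : ∀ n : ℕ, ∃ v, F v < I + 1 / ((n : ℝ) + 1) := fun n =>
    exists_lt_of_ciInf_lt (lt_add_of_pos_right I (by positivity))
  choose v hv using hex
  -- The midpoint of `x` and `y` also has energy at least `I`, so near-minimizers are close to each
  -- other.
  have hpar : ∀ x y : D, α * ‖(x : H) - y‖ ^ 2 ≤ 2 * F x + 2 * F y - 4 * I := fun x y => by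
    have h1 := hI ((1 / 2 : ℝ) • (x + y))
    have h2 := hnn (x - y)
    have h3 := parallelogram_law_with_norm ℝ ((x : H) - u) ((y : H) - u)
    have h4 : ‖(((1 / 2 : ℝ) • (x + y) : D) : H) - u‖ ^ 2 =
        1 / 4 * ‖((x : H) - u) + ((y : H) - u)‖ ^ 2 := by
      rw [show (((1 / 2 : ℝ) • (x + y) : D) : H) - u =
          (1 / 2 : ℝ) • (((x : H) - u) + ((y : H) - u)) by
        rw [Submodule.coe_smul, Submodule.coe_add]; module, norm_smul, mul_pow]
      norm_num
    have h5 : ((x : H) - u) - ((y : H) - u) = x - y := by abel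
    simp only [F] at h1 ⊢
    rw [h4] at h1
    rw [h5] at h3
    simp only [map_add, map_sub, LinearMap.add_apply, LinearMap.sub_apply, map_smul,
      LinearMap.smul_apply, smul_eq_mul, hsymm y x] at h1 h2
    nlinarith
  have hlim : Tendsto (fun n : ℕ => 1 / ((n : ℝ) + 1)) atTop (𝓝 0) :=
    tendsto_one_div_add_atTop_nhds_zero_nat
  have hcauchy : CauchySeq fun n => (v n : H) := by
    rw [Metric.cauchySeq_iff]
    intro ε hε
    obtain ⟨N, hN⟩ := (hlim.eventually (gt_mem_nhds
      (show (0 : ℝ) < α * ε ^ 2 / 4 by positivity))).exists_forall_of_atTop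
    refine ⟨N, fun m hm n hn => ?_⟩
    have h1 := hpar (v m) (v n)
    have h2 := hv m
    have h3 := hv n
    have h4 := hN m hm
    have h5 := hN n hn
    rw [dist_eq_norm]
    refine lt_of_pow_lt_pow_left₀ 2 hε.le (lt_of_mul_lt_mul_left ?_ hα.le)
    linarith
  obtain ⟨x, hx⟩ := cauchySeq_tendsto_of_complete hcauchy
  have hnorm : Tendsto (fun n => α * ‖(v n : H) - u‖ ^ 2) atTop (𝓝 (α * ‖x - u‖ ^ 2)) :=
    ((hx.sub_const u).norm.pow 2).const_mul α
  have hle : ∀ ε > 0, ∃ hx : x ∈ D, B ⟨x, hx⟩ ⟨x, hx⟩ ≤ I - α * ‖x - u‖ ^ 2 + ε := fun ε hε => by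
    obtain ⟨N, hN⟩ := ((hlim.eventually (gt_mem_nhds (half_pos hε))).and
      (hnorm.eventually (lt_mem_nhds (sub_lt_self _ (half_pos hε))))).exists_forall_of_atTop
    refine hlsc (fun n => v (n + N)) x _ (hx.comp (tendsto_add_atTop_nat N)) fun n => ?_
    obtain ⟨h1, h2⟩ := hN (n + N) (Nat.le_add_left _ _)
    have h3 := hv (n + N)
    simp only [F] at h3
    linarith
  obtain ⟨hxD, -⟩ := hle 1 one_pos
  refine ⟨⟨x, hxD⟩, isResolventSolution_of_forall_le hsymm fun w => le_trans ?_ (hI w)⟩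
  refine le_of_forall_pos_le_add fun ε hε => ?_
  obtain ⟨_, h⟩ := hle ε hε
  dsimp only
  linarith

namespace IsResolventSolution

variable {α : ℝ}

theorem add {u u' : H} {v v' : D} (h : IsResolventSolution B α u v)
    (h' : IsResolventSolution B α u' v') : IsResolventSolution B α (u + u') (v + v') := fun w => by
  rw [map_add, LinearMap.add_apply, h w, h' w, ← mul_add, ← inner_add_left, Submodule.coe_add]
  congr 2
  abel

theorem smul (c : ℝ) {u : H} {v : D} (h : IsResolventSolution B α u v) :
    IsResolventSolution B α (c • u) (c • v) := fun w => by
  rw [map_smul, LinearMap.smul_apply, h w, Submodule.coe_smul, ← smul_sub, inner_smul_left]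
  simp
  ring

/-- Symmetry of the resolvent, from testing each equation with the other solution. -/
theorem inner_comm (hsymm : ∀ x y, B x y = B y x) (hα : α ≠ 0) {u u' : H} {v v' : D}
    (h : IsResolventSolution B α u v) (h' : IsResolventSolution B α u' v') :
    inner ℝ (v : H) u' = inner ℝ u (v' : H) := by
  have h1 := h v'
  have h2 := h' v
  rw [hsymm, h1] at h2
  have h3 := mul_left_cancel₀ hα h2
  rw [inner_sub_left, inner_sub_left, real_inner_comm (v : H) u', real_inner_comm (v : H) v'] at h3
  linarith

/-- The form at the resolvent converges to the form: the distance to `u` is arbitrarily small for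
a suitable parameter. -/
theorem exists_form_sub_lt [CompleteSpace H] (hsymm : ∀ x y, B x y = B y x)
    (hnn : ∀ x, 0 ≤ B x x) (hlsc : IsLscForm B) (u : D) {ε : ℝ} (hε : 0 < ε) :
    ∃ α : ℝ, 0 < α ∧ ∃ v : D, IsResolventSolution B α (u : H) v ∧ B (u - v) (u - v) < ε := by
  have hpos : ∀ n : ℕ, (0 : ℝ) < n + 1 := fun n => by positivity
  choose v hv using fun n : ℕ => exists_isResolventSolution hsymm hnn hlsc (hpos n) (u : H)
  -- Obtained by testing the resolvent equation with `u - v n`.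
  have hid : ∀ n, B (u - v n) (u - v n) + 2 * ((n + 1) * ‖(u : H) - v n‖ ^ 2) =
      B u u - B (v n) (v n) := fun n => by
    have h1 := hv n (u - v n)
    rw [Submodule.coe_sub, real_inner_self_eq_norm_sq] at h1
    simp only [map_sub, LinearMap.sub_apply, hsymm u (v n)] at h1 ⊢
    linarith
  have hnorm : ∀ n : ℕ, ‖(u : H) - v n‖ ^ 2 ≤ B u u * (1 / ((n : ℝ) + 1)) := fun n => by
    rw [mul_one_div, le_div_iff₀ (hpos n)]
    have h1 := hid n
    have h2 := hnn (u - v n)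
    have h3 := hnn (v n)
    have h4 : 0 ≤ ((n : ℝ) + 1) * ‖(u : H) - v n‖ ^ 2 := by positivity
    linarith
  have htend : Tendsto (fun n => (v n : H)) atTop (𝓝 (u : H)) := by
    have h1 : Tendsto (fun n => ‖(u : H) - v n‖ ^ 2) atTop (𝓝 0) :=
      squeeze_zero (fun n => sq_nonneg _) hnorm
        (by simpa using tendsto_one_div_add_atTop_nhds_zero_nat.const_mul (B u u))
    rw [tendsto_iff_norm_sub_tendsto_zero]
    have h2 := h1.sqrt
    simpa [Real.sqrt_sq, norm_sub_rev] using h2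
  -- If the energy distance stayed at least `ε`, then `B(v n, v n) ≤ B(u, u) - ε` by `hid`, and
  -- lower semicontinuity would give `B(u, u) ≤ B(u, u) - ε`.
  by_contra! hcon
  obtain ⟨_, h⟩ := hlsc v u (B u u - ε) htend fun n => by
    have h1 := hcon _ (hpos n) (v n) (hv n)
    have h2 := hid n
    have h4 : 0 ≤ ((n : ℝ) + 1) * ‖(u : H) - v n‖ ^ 2 := mul_nonneg (hpos n).le (sq_nonneg _)
    linarith
  exact absurd h (by simpa using hε)

end IsResolventSolution

end Resolvent

/-! ### Positivity of the resolvent and the Hardy inequality on `L²` -/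

section PositivityPreserving

variable {X : Type*} [MeasurableSpace X] {μ : Measure X}

theorem inner_L2_eq_integral_mul (u v : Lp ℝ 2 μ) : inner ℝ u v = ∫ x, u x * v x ∂μ := by
  rw [L2.inner_def]
  simp [mul_comm]

theorem integrable_L2_mul (u v : Lp ℝ 2 μ) : Integrable (fun x => u x * v x) μ := by
  simpa [mul_comm] using L2.integrable_inner (𝕜 := ℝ) u v

theorem inner_L2_nonneg {u v : Lp ℝ 2 μ} (hu : 0 ≤ u) (hv : 0 ≤ v) : 0 ≤ inner ℝ u v := by
  rw [inner_L2_eq_integral_mul]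
  refine integral_nonneg_of_ae ?_
  filter_upwards [(Lp.coeFn_nonneg u).2 hu, (Lp.coeFn_nonneg v).2 hv] with x hx hy
  exact mul_nonneg hx hy

variable {D : Submodule ℝ (Lp ℝ 2 μ)} {B : LinearMap.BilinForm ℝ D}

/-- Test with `|v| - v`. Beurling-Deny and `B(|v| - v, |v| - v) ≥ 0` give `B(v, |v| - v) ≤ 0`;
together with `u ≥ 0` this forces `⟪v, |v|⟫ ≥ ‖v‖²`, so `|v| = v`. -/
theorem IsResolventSolution.nonneg (hsymm : ∀ x y, B x y = B y x) (hnn : ∀ x, 0 ≤ B x x)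
    (hBD : ∀ u : D, ∃ hu : |(u : Lp ℝ 2 μ)| ∈ D, B ⟨_, hu⟩ ⟨_, hu⟩ ≤ B u u) {α : ℝ} (hα : 0 < α)
    {u : Lp ℝ 2 μ} {v : D} (h : IsResolventSolution B α u v) (hu : 0 ≤ u) :
    0 ≤ (v : Lp ℝ 2 μ) := by
  obtain ⟨hv, hle⟩ := hBD v
  set w : D := ⟨_, hv⟩
  have hw : (w : Lp ℝ 2 μ) = |(v : Lp ℝ 2 μ)| := rfl
  have h1 := hnn (w - v)
  have h2 := h (w - v)
  simp only [map_sub, LinearMap.sub_apply, hsymm w v] at h1 h2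
  rw [Submodule.coe_sub, inner_sub_left, hw] at h2
  have h3 : 0 ≤ inner ℝ u (|(v : Lp ℝ 2 μ)| - v) :=
    inner_L2_nonneg hu (sub_nonneg.2 (le_abs_self _))
  have h4 : inner ℝ u (|(v : Lp ℝ 2 μ)| - v) - inner ℝ (v : Lp ℝ 2 μ) (|(v : Lp ℝ 2 μ)| - v) ≤ 0 := by
    by_contra! hcon
    have := mul_pos hα hcon
    linarith
  have h5 : ‖|(v : Lp ℝ 2 μ)| - v‖ ^ 2 ≤ 0 := by
    rw [norm_sub_sq_real, norm_abs_eq_norm, real_inner_comm]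
    rw [inner_sub_right (v : Lp ℝ 2 μ), real_inner_self_eq_norm_sq] at h4
    linarith
  have h6 : |(v : Lp ℝ 2 μ)| - v = 0 := by
    rw [← norm_eq_zero]
    exact pow_eq_zero_iff two_ne_zero |>.1 (le_antisymm h5 (sq_nonneg _))
  rw [← sub_eq_zero.1 h6]
  exact abs_nonneg _

theorem quadratic_nonneg_of_forall_rat {a b c : ℝ}
    (h : ∀ t : ℚ, 0 ≤ c + (-2 * (t : ℝ)) * b + (t : ℝ) ^ 2 * a) (t : ℝ) :
    0 ≤ c + (-2 * t) * b + t ^ 2 * a := by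
  have hcl : IsClosed {t : ℝ | 0 ≤ c + (-2 * t) * b + t ^ 2 * a} :=
    isClosed_le continuous_const (by fun_prop)
  exact (Rat.denseRange_cast (𝕜 := ℝ)).induction_on t hcl h

/-- The abstract Hardy inequality for the resolvent. -/
theorem IsResolventSolution.inner_le_inner (hsymm : ∀ x y, B x y = B y x) (hnn : ∀ x, 0 ≤ B x x)
    (hBD : ∀ u : D, ∃ hu : |(u : Lp ℝ 2 μ)| ∈ D, B ⟨_, hu⟩ ⟨_, hu⟩ ≤ B u u) {α : ℝ} (hα : 0 < α)
    {a b c : Lp ℝ 2 μ} {v₁ v₂ v₃ : D} {F : X → ℝ} (ha : 0 ≤ a)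
    (hb : ∀ᵐ x ∂μ, b x = a x * F x) (hc : ∀ᵐ x ∂μ, c x = a x * F x ^ 2)
    (h₁ : IsResolventSolution B α a v₁) (h₂ : IsResolventSolution B α b v₂)
    (h₃ : IsResolventSolution B α c v₃) :
    inner ℝ b (v₂ : Lp ℝ 2 μ) ≤ inner ℝ a (v₃ : Lp ℝ 2 μ) := by
  have hpos : ∀ t : ℝ, 0 ≤ ((v₃ + (-2 * t) • v₂ + t ^ 2 • v₁ : D) : Lp ℝ 2 μ) := fun t => by
    refine ((h₃.add (h₂.smul (-2 * t))).add (h₁.smul (t ^ 2))).nonneg hsymm hnn hBD hα ?_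
    rw [← Lp.coeFn_nonneg]
    filter_upwards [hb, hc, (Lp.coeFn_nonneg a).2 ha, Lp.coeFn_add (c + (-2 * t) • b) (t ^ 2 • a),
      Lp.coeFn_add c ((-2 * t) • b), Lp.coeFn_smul (-2 * t) b, Lp.coeFn_smul (t ^ 2) a]
      with x hb hc ha h1 h2 h3 h4
    simp only [h1, h2, h3, h4, Pi.add_apply, Pi.smul_apply, smul_eq_mul, Pi.zero_apply, hb, hc] at ha ⊢
    calc 0 ≤ a x * (F x - t) ^ 2 := mul_nonneg ha (sq_nonneg _)
      _ = _ := by ring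
  -- One null set must serve all `t`, since `t = F x` is inserted below; rational `t` and continuity
  -- provide it.
  have hae : ∀ᵐ x ∂μ, ∀ t : ℝ, 0 ≤ (v₃ : Lp ℝ 2 μ) x + (-2 * t) * (v₂ : Lp ℝ 2 μ) x +
      t ^ 2 * (v₁ : Lp ℝ 2 μ) x := by
    have : ∀ᵐ x ∂μ, ∀ t : ℚ, 0 ≤ (v₃ : Lp ℝ 2 μ) x + (-2 * (t : ℝ)) * (v₂ : Lp ℝ 2 μ) x +
        (t : ℝ) ^ 2 * (v₁ : Lp ℝ 2 μ) x := by
      refine ae_all_iff.2 fun t => ?_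
      filter_upwards [(Lp.coeFn_nonneg _).2 (hpos t),
        Lp.coeFn_add ((v₃ : Lp ℝ 2 μ) + (-2 * (t : ℝ)) • (v₂ : Lp ℝ 2 μ))
          ((t : ℝ) ^ 2 • (v₁ : Lp ℝ 2 μ)),
        Lp.coeFn_add (v₃ : Lp ℝ 2 μ) ((-2 * (t : ℝ)) • (v₂ : Lp ℝ 2 μ)),
        Lp.coeFn_smul (-2 * (t : ℝ)) (v₂ : Lp ℝ 2 μ), Lp.coeFn_smul ((t : ℝ) ^ 2) (v₁ : Lp ℝ 2 μ)]
        with x h0 h1 h2 h3 h4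
      simpa only [Submodule.coe_add, Submodule.coe_smul, h1, h2, h3, h4, Pi.add_apply,
        Pi.smul_apply, smul_eq_mul, Pi.zero_apply] using h0
    filter_upwards [this] with x hx using quadratic_nonneg_of_forall_rat hx
  have hfin : 0 ≤ inner ℝ a (v₃ : Lp ℝ 2 μ) - 2 * inner ℝ b (v₂ : Lp ℝ 2 μ) +
      inner ℝ c (v₁ : Lp ℝ 2 μ) := by
    have i₁ := integrable_L2_mul a (v₃ : Lp ℝ 2 μ)
    have i₂ := (integrable_L2_mul b (v₂ : Lp ℝ 2 μ)).const_mul 2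
    have i₃ := integrable_L2_mul c (v₁ : Lp ℝ 2 μ)
    simp only [inner_L2_eq_integral_mul]
    rw [← integral_const_mul, ← integral_sub i₁ i₂]
    refine le_of_le_of_eq ?_ (integral_add (i₁.sub i₂) i₃)
    refine integral_nonneg_of_ae ?_
    filter_upwards [hb, hc, (Lp.coeFn_nonneg a).2 ha, hae] with x hb hc ha h
    simp only [Pi.zero_apply, hb, hc]
    calc (0 : ℝ) ≤ a x * _ := mul_nonneg ha (h (F x))
      _ = _ := by ring
  have h13 := h₁.inner_comm hsymm hα.ne' h₃
  rw [real_inner_comm] at h13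
  linarith

/-- The abstract Hardy inequality for lower semicontinuous forms on `L²`. -/
theorem bilinForm_le_of_mul_sq (hsymm : ∀ x y, B x y = B y x) (hnn : ∀ x, 0 ≤ B x x)
    (hlsc : IsLscForm B)
    (hBD : ∀ u : D, ∃ hu : |(u : Lp ℝ 2 μ)| ∈ D, B ⟨_, hu⟩ ⟨_, hu⟩ ≤ B u u)
    (a b c : D) (F : X → ℝ) (ha : 0 ≤ (a : Lp ℝ 2 μ))
    (hb : ∀ᵐ x ∂μ, (b : Lp ℝ 2 μ) x = (a : Lp ℝ 2 μ) x * F x)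
    (hc : ∀ᵐ x ∂μ, (c : Lp ℝ 2 μ) x = (a : Lp ℝ 2 μ) x * F x ^ 2) : B c a ≤ B b b := by
  refine le_of_forall_pos_le_add fun ε hε => ?_
  -- The bound is chosen so that Cauchy-Schwarz yields `B(c - v₃, a) ≤ ε`; the `+ 1` covers `B(a, a)
  -- = 0`.
  obtain ⟨α, hα, v₃, h₃, hlt⟩ := IsResolventSolution.exists_form_sub_lt hsymm hnn hlsc c
    (show 0 < ε ^ 2 / (B a a + 1) from div_pos (pow_pos hε 2) (by linarith [hnn a]))
  obtain ⟨v₁, h₁⟩ := exists_isResolventSolution hsymm hnn hlsc hα (a : Lp ℝ 2 μ)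
  obtain ⟨v₂, h₂⟩ := exists_isResolventSolution hsymm hnn hlsc hα (b : Lp ℝ 2 μ)
  have hle := h₁.inner_le_inner hsymm hnn hBD hα ha hb hc h₂ h₃
  have heq : inner ℝ (c : Lp ℝ 2 μ) (a : Lp ℝ 2 μ) = inner ℝ (b : Lp ℝ 2 μ) (b : Lp ℝ 2 μ) := by
    rw [inner_L2_eq_integral_mul, inner_L2_eq_integral_mul]
    refine integral_congr_ae ?_
    filter_upwards [hb, hc] with x hb hc
    rw [hb, hc]
    ring
  have hres : B v₃ a ≤ B v₂ b := by
    rw [h₃ a, h₂ b, inner_sub_left, inner_sub_left, heq, real_inner_comm (a : Lp ℝ 2 μ),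
      real_inner_comm (b : Lp ℝ 2 μ) v₂]
    exact mul_le_mul_of_nonneg_left (by linarith) hα.le
  have hb' : B v₂ b ≤ B b b := by
    have h1 := h₂ (b - v₂)
    have h2 := hnn (b - v₂)
    rw [Submodule.coe_sub, real_inner_self_eq_norm_sq] at h1
    simp only [map_sub, LinearMap.sub_apply, hsymm b v₂] at h1 h2
    have : 0 ≤ α * ‖(b : Lp ℝ 2 μ) - v₂‖ ^ 2 := by positivity
    linarith
  have hc' : B (c - v₃) a ≤ ε := by
    refine le_of_sq_le_sq ?_ hε.le
    refine (cauchySchwarz_bilinForm hsymm hnn _ _).trans ?_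
    rw [lt_div_iff₀ (by linarith [hnn a])] at hlt
    nlinarith [hnn (c - v₃), hnn a]
  rw [map_sub, LinearMap.sub_apply] at hc'
  linarith

end PositivityPreserving

/-! ### Energy-Cauchy convex combinations -/

section ConvexCombinations

theorem tendsto_natCast_succ_inv : Tendsto (fun n : ℕ => ((n + 1 : ℕ) : ℝ≥0∞)⁻¹) atTop (𝓝 0) :=
  ENNReal.tendsto_inv_nat_nhds_zero.comp (tendsto_add_atTop_nat 1)

theorem liminf_add_liminf_le_of_forall_add_le {a b : ℕ → ℝ≥0∞} {M : ℝ≥0∞}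
    (h : ∀ n, a n + b n ≤ M) : liminf a atTop + liminf b atTop ≤ M := by
  rw [liminf_eq_iSup_iInf_of_nat, liminf_eq_iSup_iInf_of_nat]
  refine ENNReal.iSup_add_iSup_le fun i j => le_trans ?_ (h (max i j))
  exact add_le_add (iInf₂_le _ (le_max_left i j)) (iInf₂_le _ (le_max_right i j))

/-- Convex combinations of the tails of a `q`-bounded sequence can be chosen to be `q`-Cauchy. -/
theorem IsQuadForm.exists_isFormCauchy_convexHull {V : Type*} [AddCommGroup V] [Module ℝ V]
    {q : V → ℝ≥0∞} (hq : IsQuadForm q) {u : ℕ → V} {C : ℝ≥0∞} (hC : C ≠ ∞) (hu : ∀ n, q (u n) ≤ C) :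
    ∃ v : ℕ → V, IsFormCauchy q v ∧ (∀ n, v n ∈ convexHull ℝ (u '' Set.Ici n)) ∧
      ∀ n, q (v n) ≤ C + ((n + 1 : ℕ) : ℝ≥0∞)⁻¹ := by
  let S : ℕ → Set V := fun n => convexHull ℝ (u '' Set.Ici n)
  have hS : Antitone S := fun m n hmn =>
    convexHull_mono (Set.image_mono (Set.Ici_subset_Ici.2 hmn))
  -- The minimal energies of the tail hulls increase to a finite limit. Midpoints of near-minimizers
  -- stay in the hull, so the parallelogram identity makes near-minimizers `q`-Cauchy.
  let d : ℕ → ℝ≥0∞ := fun n => ⨅ x ∈ S n, q x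
  have hd : ∀ n x, x ∈ S n → d n ≤ q x := fun n x hx => iInf₂_le x hx
  have hmono : Monotone d := fun m n hmn => iInf_le_iInf_of_subset (hS hmn)
  have hdC : ∀ n, d n ≤ C := fun n =>
    (hd n _ (subset_convexHull ℝ _ ⟨n, Set.mem_Ici.2 le_rfl, rfl⟩)).trans (hu n)
  have hex : ∀ n, ∃ x ∈ S n, q x < d n + ((n + 1 : ℕ) : ℝ≥0∞)⁻¹ := fun n => by
    have : d n < d n + ((n + 1 : ℕ) : ℝ≥0∞)⁻¹ :=
      ENNReal.lt_add_right ((hdC n).trans_lt hC.lt_top).ne (by simp)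
    simpa only [d, iInf_lt_iff, exists_prop] using this
  choose v hvS hv using hex
  have hvC : ∀ n, q (v n) ≤ C + ((n + 1 : ℕ) : ℝ≥0∞)⁻¹ := fun n =>
    (hv n).le.trans (by gcongr; exact hdC n)
  refine ⟨v, ⟨fun n => (hvC n).trans_lt (ENNReal.add_lt_top.2 ⟨hC.lt_top, by simp⟩),
    fun ε hε => ?_⟩, hvS, hvC⟩
  obtain ⟨δ, hδ, hδε⟩ : ∃ δ : ℝ≥0∞, 0 < δ ∧ 8 * δ < ε := by
    obtain ⟨η, hη, hηε⟩ := exists_between hε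
    have h8 : η / 8 * 8 = η := ENNReal.div_mul_cancel (by norm_num) (by norm_num)
    exact ⟨η / 8, ENNReal.div_pos hη.ne' (by norm_num), by rwa [mul_comm, h8]⟩
  have hD : (⨆ n, d n) ≠ ∞ := ((iSup_le hdC).trans_lt hC.lt_top).ne
  obtain ⟨N, hN⟩ := (((((tendsto_atTop_iSup hmono).add_const δ).eventually
    (lt_mem_nhds (ENNReal.lt_add_right hD hδ.ne'))).and
    (tendsto_natCast_succ_inv.eventually (gt_mem_nhds hδ)))).exists_forall_of_atTop
  refine ⟨N, fun m hm n hn => lt_of_le_of_lt ?_ hδε⟩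
  have hbound : ∀ k ≥ N, q (v k) ≤ d N + 2 * δ := fun k hk => by
    calc q (v k) ≤ d k + ((k + 1 : ℕ) : ℝ≥0∞)⁻¹ := (hv k).le
      _ ≤ (d N + δ) + δ := by
        gcongr
        · exact (le_iSup d k).trans (hN N le_rfl).1.le
        · exact (hN k hk).2.le
      _ = d N + 2 * δ := by ring
  have hmid : 4 * d N ≤ q (v m + v n) := by
    have hmem : (1 / 2 : ℝ) • v m + (1 / 2 : ℝ) • v n ∈ S N :=
      convex_convexHull ℝ _ (hS hm (hvS m)) (hS hn (hvS n)) (by norm_num) (by norm_num)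
        (by norm_num)
    have h1 := hq.smul 2 ((1 / 2 : ℝ) • v m + (1 / 2 : ℝ) • v n)
    rw [show (2 : ℝ) • ((1 / 2 : ℝ) • v m + (1 / 2 : ℝ) • v n) = v m + v n by module] at h1
    rw [h1, show ENNReal.ofReal (2 ^ 2) = 4 by norm_num]
    gcongr
    exact hd N _ hmem
  have hfin : 4 * d N ≠ ∞ := ENNReal.mul_ne_top (by norm_num) ((hdC N).trans_lt hC.lt_top).ne
  refine (ENNReal.add_le_add_iff_left hfin).1 ?_
  calc 4 * d N + q (v m - v n) ≤ q (v m + v n) + q (v m - v n) := by gcongr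
    _ = 2 * q (v m) + 2 * q (v n) := hq.parallelogram _ _
    _ ≤ 2 * (d N + 2 * δ) + 2 * (d N + 2 * δ) := by
      gcongr
      · exact hbound m hm
      · exact hbound n hn
    _ = 4 * d N + 8 * δ := by ring

theorem tendsto_of_mem_convexHull_tail {E : Type*} [NormedAddCommGroup E] [NormedSpace ℝ E]
    {u v : ℕ → E} {x : E} (hu : Tendsto u atTop (𝓝 x))
    (hv : ∀ n, v n ∈ convexHull ℝ (u '' Set.Ici n)) : Tendsto v atTop (𝓝 x) := by
  rw [Metric.tendsto_atTop] at hu ⊢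
  intro ε hε
  obtain ⟨N, hN⟩ := hu ε hε
  refine ⟨N, fun n hn => ?_⟩
  have hsub : u '' Set.Ici n ⊆ Metric.ball x ε := by
    rintro _ ⟨k, hk, rfl⟩
    exact hN k (hn.trans hk)
  exact convexHull_min hsub (convex_ball x ε) (hv n)

end ConvexCombinations

/-! ### The extended form: quadratic, lower semicontinuous, Beurling-Deny -/

section ExtendedForm

variable {X : Type*} [MeasurableSpace X] {μ : Measure X}

/-- Reduces convex combinations to the real line, pointwise a.e.; there they preserve limits because
balls are convex. -/
theorem Lp.ae_mem_convexHull {p : ℝ≥0∞} {u : ℕ → Lp ℝ p μ} {n : ℕ} {v : Lp ℝ p μ}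
    (hv : v ∈ convexHull ℝ (u '' Set.Ici n)) :
    ∀ᵐ x ∂μ, v x ∈ convexHull ℝ ((fun k => u k x) '' Set.Ici n) := by
  have hconv : Convex ℝ {v : Lp ℝ p μ |
      ∀ᵐ x ∂μ, v x ∈ convexHull ℝ ((fun k => u k x) '' Set.Ici n)} := by
    intro v hv w hw s t hs ht hst
    filter_upwards [hv, hw, Lp.coeFn_add (s • v) (t • w), Lp.coeFn_smul s v, Lp.coeFn_smul t w]
      with x hv hw h1 h2 h3
    rw [h1, Pi.add_apply, h2, h3]
    exact convex_convexHull ℝ _ hv hw hs ht hst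
  refine convexHull_min ?_ hconv hv
  rintro _ ⟨k, hk, rfl⟩
  change ∀ᵐ x ∂μ, u k x ∈ _
  exact Eventually.of_forall fun x => subset_convexHull ℝ _
    (Set.mem_image_of_mem (fun k => u k x) hk)

theorem tendstoL0_of_ae_tendsto {u : ℕ → X →ₘ[μ] ℝ} {f : X →ₘ[μ] ℝ}
    (h : ∀ᵐ x ∂μ, Tendsto (fun n => u n x) atTop (𝓝 (f x))) : TendstoL0 u f := by
  intro φ hφ hpos hint
  have hmeas : ∀ n, AEStronglyMeasurable (fun x => min |(u n - f) x| 1 * φ x) μ := fun n =>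
    ((continuous_abs.min continuous_const).comp_aestronglyMeasurable
      (u n - f).aestronglyMeasurable).mul hint.aestronglyMeasurable
  have hsub : ∀ᵐ x ∂μ, ∀ n, (u n - f) x = u n x - f x :=
    ae_all_iff.2 fun n => AEEqFun.coeFn_sub (u n) f
  rw [show (0 : ℝ) = ∫ _, (0 : ℝ) ∂μ by simp]
  refine tendsto_integral_of_dominated_convergence φ hmeas hint (fun n => ?_) ?_
  · refine Eventually.of_forall fun x => ?_
    rw [Real.norm_eq_abs, abs_of_nonneg (mul_nonneg (le_min (abs_nonneg _) zero_le_one) (hpos x).le)]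
    exact mul_le_of_le_one_left (hpos x).le (min_le_right _ _)
  · filter_upwards [h, hsub] with x hx hsub
    simp only [hsub]
    have h1 : Tendsto (fun n => u n x - f x) atTop (𝓝 0) := by
      simpa using hx.sub_const (f x)
    simpa using ((h1.abs.min (tendsto_const_nhds (x := (1 : ℝ)))).mul_const (φ x))

theorem exists_pos_measurable_integrable (μ : Measure X) [SigmaFinite μ] :
    ∃ φ : X → ℝ, Measurable φ ∧ (∀ x, 0 < φ x) ∧ Integrable φ μ := by
  obtain ⟨g, hpos, hmeas, hlt⟩ := exists_pos_lintegral_lt_of_sigmaFinite μ one_ne_zero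
  refine ⟨fun x => g x, hmeas.coe_nnreal_real, fun x => hpos x,
    hmeas.coe_nnreal_real.aestronglyMeasurable, ?_⟩
  rw [hasFiniteIntegral_iff_ofReal (Eventually.of_forall fun x => (g x).coe_nonneg)]
  simpa using hlt.trans ENNReal.one_lt_top

theorem exists_subseq_ae_tendsto_zero_of_fNorm {φ : X → ℝ} (hpos : ∀ x, 0 < φ x)
    (hint : Integrable φ μ) {g : ℕ → X →ₘ[μ] ℝ}
    (hg : Tendsto (fun n => fNorm φ (g n)) atTop (𝓝 0)) :
    ∃ ns : ℕ → ℕ, StrictMono ns ∧ ∀ᵐ x ∂μ, Tendsto (fun k => g (ns k) x) atTop (𝓝 0) := by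
  let F : ℕ → X → ℝ := fun n x => min |g n x| 1 * φ x
  have hFnn : ∀ n x, 0 ≤ F n x := fun n x =>
    mul_nonneg (le_min (abs_nonneg _) zero_le_one) (hpos x).le
  have hmeas : ∀ n, AEStronglyMeasurable (F n) μ := fun n =>
    ((continuous_abs.min continuous_const).comp_aestronglyMeasurable
      (g n).aestronglyMeasurable).mul hint.aestronglyMeasurable
  have hFint : ∀ n, Integrable (F n) μ := fun n => hint.mono' (hmeas n) <|
    Eventually.of_forall fun x => by
      rw [Real.norm_eq_abs, abs_of_nonneg (hFnn n x)]
      exact mul_le_of_le_one_left (hpos x).le (min_le_right _ _)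
  have hL1 : Tendsto (fun n => eLpNorm (F n - 0) 1 μ) atTop (𝓝 0) := by
    have : ∀ n, eLpNorm (F n - 0) 1 μ = ENNReal.ofReal (fNorm φ (g n)) := fun n => by
      rw [sub_zero, eLpNorm_one_eq_lintegral_enorm, fNorm,
        ofReal_integral_eq_lintegral_ofReal (hFint n) (Eventually.of_forall (hFnn n))]
      exact lintegral_congr fun x => Real.enorm_of_nonneg (hFnn n x)
    simp only [this]
    simpa using ENNReal.tendsto_ofReal hg
  obtain ⟨ns, hns, hae⟩ := (tendstoInMeasure_of_tendsto_eLpNorm one_ne_zero hmeas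
    aestronglyMeasurable_zero hL1).exists_seq_tendsto_ae
  refine ⟨ns, hns, hae.mono fun x hx => ?_⟩
  have h1 : Tendsto (fun k => min |g (ns k) x| 1) atTop (𝓝 0) := by
    simpa [F, (hpos x).ne'] using hx.mul_const (φ x)⁻¹
  rw [tendsto_zero_iff_abs_tendsto_zero]
  refine h1.congr' ?_
  filter_upwards [h1.eventually (gt_mem_nhds zero_lt_one)] with k hk
  exact min_eq_left ((min_lt_iff.1 hk).resolve_right (lt_irrefl _)).le

theorem TendstoL0.exists_subseq_ae_tendsto [SigmaFinite μ] {u : ℕ → X →ₘ[μ] ℝ} {f : X →ₘ[μ] ℝ}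
    (h : TendstoL0 u f) :
    ∃ ns : ℕ → ℕ, StrictMono ns ∧ ∀ᵐ x ∂μ, Tendsto (fun k => u (ns k) x) atTop (𝓝 (f x)) := by
  obtain ⟨φ, hmeas, hpos, hint⟩ := exists_pos_measurable_integrable μ
  obtain ⟨ns, hns, hae⟩ := exists_subseq_ae_tendsto_zero_of_fNorm hpos hint (h φ hmeas hpos hint)
  refine ⟨ns, hns, ?_⟩
  have hsub : ∀ᵐ x ∂μ, ∀ n, (u n - f) x = u n x - f x :=
    ae_all_iff.2 fun n => AEEqFun.coeFn_sub (u n) f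
  filter_upwards [hae, hsub] with x hx hsub
  simpa [hsub] using hx.add_const (f x)

variable {q : Lp ℝ 2 μ → ℝ≥0∞}

/-- With `IsQuadForm.extendedForm_le_of_forall_le` as converse, this replaces `q`-Cauchy sequences
by energy-bounded, a.e. convergent ones, which are stable under absolute values and subsequences. -/
theorem exists_seq_of_extendedForm_lt [SigmaFinite μ] {f : X →ₘ[μ] ℝ} {c : ℝ≥0∞}
    (h : extendedForm q f < c) :
    ∃ u : ℕ → Lp ℝ 2 μ, (∀ n, q (u n) < c) ∧
      ∀ᵐ x ∂μ, Tendsto (fun n => u n x) atTop (𝓝 (f x)) := by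
  obtain ⟨_, ⟨u, -, hu, rfl⟩, hlt⟩ := sInf_lt_iff.1 h
  obtain ⟨ns, hns, hlt⟩ := extraction_of_frequently_atTop (frequently_lt_of_liminf_lt
    (by isBoundedDefault) hlt)
  have hu' : TendstoL0 (fun n => (u (ns n) : X →ₘ[μ] ℝ)) f := fun φ h1 h2 h3 =>
    (hu φ h1 h2 h3).comp hns.tendsto_atTop
  obtain ⟨ms, -, hae⟩ := hu'.exists_subseq_ae_tendsto
  exact ⟨fun k => u (ns (ms k)), fun k => hlt _, hae⟩

theorem IsQuadForm.extendedForm_le_of_forall_le (hq : IsQuadForm q) {u : ℕ → Lp ℝ 2 μ}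
    {f : X →ₘ[μ] ℝ} {C : ℝ≥0∞} (hu : ∀ n, q (u n) ≤ C)
    (hf : ∀ᵐ x ∂μ, Tendsto (fun n => u n x) atTop (𝓝 (f x))) : extendedForm q f ≤ C := by
  rcases eq_or_ne C ∞ with rfl | hC
  · exact le_top
  obtain ⟨v, hcauchy, hv, hle⟩ := hq.exists_isFormCauchy_convexHull hC hu
  have hae : ∀ᵐ x ∂μ, Tendsto (fun n => v n x) atTop (𝓝 (f x)) := by
    filter_upwards [hf, ae_all_iff.2 fun n => Lp.ae_mem_convexHull (hv n)] with x hx hmem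
    exact tendsto_of_mem_convexHull_tail hx hmem
  have hmem : extendedForm q f ≤ liminf (fun n => q (v n)) atTop :=
    sInf_le ⟨v, hcauchy, tendstoL0_of_ae_tendsto hae, rfl⟩
  have hlim : Tendsto (fun n : ℕ => C + ((n + 1 : ℕ) : ℝ≥0∞)⁻¹) atTop (𝓝 C) := by
    simpa using tendsto_natCast_succ_inv.const_add C
  exact hmem.trans ((liminf_le_liminf (Eventually.of_forall hle)).trans_eq hlim.liminf_eq)

/-- The Fatou property of the extended form on `L²`. -/
theorem IsQuadForm.extendedForm_le_liminf (hq : IsQuadForm q) {u : ℕ → Lp ℝ 2 μ}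
    {f : X →ₘ[μ] ℝ} (hf : ∀ᵐ x ∂μ, Tendsto (fun n => u n x) atTop (𝓝 (f x))) :
    extendedForm q f ≤ liminf (fun n => q (u n)) atTop := by
  refine le_of_forall_gt fun c hc => ?_
  obtain ⟨c', hc', hlt⟩ := exists_between hc
  obtain ⟨ns, hns, hle⟩ := extraction_of_frequently_atTop (frequently_lt_of_liminf_lt
    (by isBoundedDefault) hc')
  exact (hq.extendedForm_le_of_forall_le (fun n => (hle n).le)
    (hf.mono fun x hx => hx.comp hns.tendsto_atTop)).trans_lt hlt

/-- Lower semicontinuity of the extended form. -/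
theorem IsQuadForm.extendedForm_le_of_ae_tendsto [SigmaFinite μ] (hq : IsQuadForm q)
    {g : ℕ → X →ₘ[μ] ℝ} {f : X →ₘ[μ] ℝ} {C : ℝ≥0∞} (hg : ∀ n, extendedForm q (g n) ≤ C)
    (hf : ∀ᵐ x ∂μ, Tendsto (fun n => g n x) atTop (𝓝 (f x))) : extendedForm q f ≤ C := by
  refine le_of_forall_gt_imp_ge_of_dense fun c hc => ?_
  obtain ⟨φ, hmeas, hpos, hint⟩ := exists_pos_measurable_integrable μ
  -- A diagonal choice needs a quantitative distance, which a.e. convergence lacks; `fNorm φ`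
  -- supplies it.
  have hex : ∀ n : ℕ, ∃ w : Lp ℝ 2 μ, q w < c ∧ fNorm φ ((w : X →ₘ[μ] ℝ) - g n) < 1 / ((n : ℝ) + 1) :=
    fun n => by
      obtain ⟨u, hu, hae⟩ := exists_seq_of_extendedForm_lt ((hg n).trans_lt hc)
      have h1 := tendstoL0_of_ae_tendsto (u := fun k => (u k : X →ₘ[μ] ℝ)) hae φ hmeas hpos hint
      obtain ⟨k, hk⟩ := (h1.eventually
        (gt_mem_nhds (show (0 : ℝ) < 1 / ((n : ℝ) + 1) by positivity))).exists
      exact ⟨u k, hu k, hk⟩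
  choose w hw hwg using hex
  have hlim : Tendsto (fun n => fNorm φ ((w n : X →ₘ[μ] ℝ) - g n)) atTop (𝓝 0) :=
    squeeze_zero (fun n => integral_nonneg fun x =>
      mul_nonneg (le_min (abs_nonneg _) zero_le_one) (hpos x).le) (fun n => (hwg n).le)
      tendsto_one_div_add_atTop_nhds_zero_nat
  obtain ⟨ns, hns, hae⟩ := exists_subseq_ae_tendsto_zero_of_fNorm hpos hint hlim
  refine hq.extendedForm_le_of_forall_le (u := fun k => w (ns k)) (fun k => (hw _).le) ?_
  have hsub : ∀ᵐ x ∂μ, ∀ n, ((w n : X →ₘ[μ] ℝ) - g n) x = w n x - g n x :=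
    ae_all_iff.2 fun n => AEEqFun.coeFn_sub _ _
  filter_upwards [hae, hf, hsub] with x hx hf hsub
  simpa [hsub] using hx.add (hf.comp hns.tendsto_atTop)

theorem extendedForm_abs_le [SigmaFinite μ] (hq : IsQuadForm q) (hBD : FirstBeurlingDeny q)
    (f : X →ₘ[μ] ℝ) : extendedForm q |f| ≤ extendedForm q f := by
  refine le_of_forall_gt_imp_ge_of_dense fun c hc => ?_
  obtain ⟨u, hu, hae⟩ := exists_seq_of_extendedForm_lt hc
  refine hq.extendedForm_le_of_forall_le (u := fun n => |u n|)
    (fun n => (hBD _).trans (hu n).le) ?_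
  filter_upwards [hae, ae_all_iff.2 fun n => Lp.coeFn_abs (u n), AEEqFun.coeFn_abs f]
    with x hx h1 h2
  simpa only [h1, h2] using hx.abs

theorem isQuadForm_extendedForm [SigmaFinite μ] (hq : IsQuadForm q) :
    IsQuadForm (extendedForm q) := by
  have hsmul_le : ∀ (c : ℝ) (f : X →ₘ[μ] ℝ), extendedForm q f ≠ ∞ →
      extendedForm q (c • f) ≤ ENNReal.ofReal (c ^ 2) * extendedForm q f := by
    intro c f hf
    have hstep : ∀ d > extendedForm q f,
        extendedForm q (c • f) ≤ ENNReal.ofReal (c ^ 2) * d := fun d hd => by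
      obtain ⟨u, hu, hae⟩ := exists_seq_of_extendedForm_lt hd
      refine hq.extendedForm_le_of_forall_le (u := fun n => c • u n) (fun n => ?_) ?_
      · rw [hq.smul]
        gcongr
        exact (hu n).le
      · filter_upwards [hae, ae_all_iff.2 fun n => Lp.coeFn_smul c (u n), AEEqFun.coeFn_smul c f]
          with x hx h1 h2
        simpa only [h1, h2, Pi.smul_apply, smul_eq_mul] using hx.const_mul c
    have hlim : Tendsto (fun n : ℕ => ENNReal.ofReal (c ^ 2) *
        (extendedForm q f + ((n + 1 : ℕ) : ℝ≥0∞)⁻¹)) atTop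
        (𝓝 (ENNReal.ofReal (c ^ 2) * (extendedForm q f + 0))) :=
      ENNReal.Tendsto.const_mul (tendsto_natCast_succ_inv.const_add _) (Or.inr ENNReal.ofReal_ne_top)
    rw [add_zero] at hlim
    exact ge_of_tendsto' hlim fun n => hstep _ (ENNReal.lt_add_right hf (by simp))
  have hsmul : ∀ (c : ℝ) (f : X →ₘ[μ] ℝ),
      extendedForm q (c • f) = ENNReal.ofReal (c ^ 2) * extendedForm q f := by
    intro c f
    rcases eq_or_ne c 0 with rfl | hc
    · have h0 : q 0 = 0 := by simpa using hq.smul 0 0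
      have : extendedForm q (0 : X →ₘ[μ] ℝ) ≤ 0 :=
        hq.extendedForm_le_of_forall_le (u := fun _ => 0) (fun _ => h0.le) (by
          filter_upwards [AEEqFun.coeFn_zero (α := X) (μ := μ) (β := ℝ)]
            with x h2
          simp [h2])
      simpa using this
    · have hinv : ENNReal.ofReal (c ^ 2) * ENNReal.ofReal ((c⁻¹) ^ 2) = 1 := by
        rw [← ENNReal.ofReal_mul (sq_nonneg c), ← mul_pow, mul_inv_cancel₀ hc]
        simp
      -- The reverse inequality is `hsmul_le` for the scalar `c⁻¹` and the function `c • f`.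
      have hge : extendedForm q (c • f) ≠ ∞ →
          ENNReal.ofReal (c ^ 2) * extendedForm q f ≤ extendedForm q (c • f) := by
        intro hfin
        have := hsmul_le c⁻¹ (c • f) hfin
        rw [inv_smul_smul₀ hc] at this
        calc _ ≤ ENNReal.ofReal (c ^ 2) * (ENNReal.ofReal ((c⁻¹) ^ 2) *
              extendedForm q (c • f)) := by gcongr
          _ = _ := by rw [← mul_assoc, hinv, one_mul]
      by_cases hf : extendedForm q f = ∞
      · rw [hf, ENNReal.mul_top (by simpa using hc)]
        by_contra hfin
        have := hge hfin
        rw [hf, ENNReal.mul_top (by simpa using hc)] at this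
        exact hfin (top_le_iff.1 this)
      · have hle := hsmul_le c f hf
        exact le_antisymm hle (hge (hle.trans_lt (ENNReal.mul_lt_top (by simp) (Ne.lt_top hf))).ne)
  have hpar : ∀ f g : X →ₘ[μ] ℝ, extendedForm q (f + g) + extendedForm q (f - g) ≤
      2 * extendedForm q f + 2 * extendedForm q g := by
    intro f g
    by_cases hf : extendedForm q f = ∞
    · simp [hf]
    by_cases hg : extendedForm q g = ∞
    · simp [hg]
    have hstep : ∀ c > extendedForm q f, ∀ d > extendedForm q g,
        extendedForm q (f + g) + extendedForm q (f - g) ≤ 2 * c + 2 * d := by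
      intro c hc d hd
      obtain ⟨u, hu, hae⟩ := exists_seq_of_extendedForm_lt hc
      obtain ⟨v, hv, hae'⟩ := exists_seq_of_extendedForm_lt hd
      have h1 : extendedForm q (f + g) ≤ liminf (fun n => q (u n + v n)) atTop := by
        refine hq.extendedForm_le_liminf ?_
        filter_upwards [hae, hae', ae_all_iff.2 fun n => Lp.coeFn_add (u n) (v n),
          AEEqFun.coeFn_add f g] with x hx hy h1 h2
        simpa only [h1, h2, Pi.add_apply] using hx.add hy
      have h2 : extendedForm q (f - g) ≤ liminf (fun n => q (u n - v n)) atTop := by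
        refine hq.extendedForm_le_liminf ?_
        filter_upwards [hae, hae', ae_all_iff.2 fun n => Lp.coeFn_sub (u n) (v n),
          AEEqFun.coeFn_sub f g] with x hx hy h1 h2
        simpa only [h1, h2, Pi.sub_apply] using hx.sub hy
      refine (add_le_add h1 h2).trans (liminf_add_liminf_le_of_forall_add_le fun n => ?_)
      refine (hq.parallelogram (u n) (v n)).trans_le ?_
      gcongr
      · exact (hu n).le
      · exact (hv n).le
    have hlim : Tendsto (fun n : ℕ => 2 * (extendedForm q f + ((n + 1 : ℕ) : ℝ≥0∞)⁻¹) +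
        2 * (extendedForm q g + ((n + 1 : ℕ) : ℝ≥0∞)⁻¹)) atTop
        (𝓝 (2 * (extendedForm q f + 0) + 2 * (extendedForm q g + 0))) :=
      (ENNReal.Tendsto.const_mul (tendsto_natCast_succ_inv.const_add _) (by simp)).add
        (ENNReal.Tendsto.const_mul (tendsto_natCast_succ_inv.const_add _) (by simp))
    simp only [add_zero] at hlim
    exact ge_of_tendsto' hlim fun n => hstep _ (ENNReal.lt_add_right hf (by simp)) _
      (ENNReal.lt_add_right hg (by simp))
  refine ⟨hsmul, fun f g => le_antisymm (hpar f g) ?_⟩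
  -- Applied to `f + g` and `f - g`, the inequality reverses itself after cancelling a factor `2`.
  have h1 := hpar (f + g) (f - g)
  have h4 : ENNReal.ofReal (2 ^ 2) = 2 * 2 := by norm_num
  rw [show f + g + (f - g) = (2 : ℝ) • f by module,
    show f + g - (f - g) = (2 : ℝ) • g by module, hsmul, hsmul, h4, mul_assoc, mul_assoc,
    ← mul_add, ← mul_add, ← mul_add] at h1
  rw [← mul_add]
  exact (ENNReal.mul_le_mul_iff_right two_ne_zero ENNReal.ofNat_ne_top).1 h1

end ExtendedForm

/-! ### Transfer to `L²` by a positive weight -/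

section Weights

variable {X : Type*} [MeasurableSpace X] {μ : Measure X}

/-- Finitely many elements of `L⁰` become square integrable after division by a common positive
weight. -/
theorem exists_pos_weight_L2 [SigmaFinite μ] {ι : Type*} [Fintype ι] (f : ι → X →ₘ[μ] ℝ) :
    ∃ (ψ : X →ₘ[μ] ℝ) (a : ι → Lp ℝ 2 μ), (∀ᵐ x ∂μ, 0 < ψ x) ∧
      ∀ i, ψ * (a i : X →ₘ[μ] ℝ) = f i := by
  obtain ⟨φ, hmeas, hpos, hint⟩ := exists_pos_measurable_integrable μ
  -- The factorization is `f i = (s / √φ) · (f i · √φ / s)`: the first factor is the weight, and the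
  -- second is bounded by `√φ ∈ L²` because `|f i| ≤ s`.
  let s : X → ℝ := fun x => 1 + ∑ i, |f i x|
  have hs : ∀ x, 0 < s x := fun x => by positivity
  have hfs : ∀ i x, |f i x| ≤ s x := fun i x =>
    (Finset.single_le_sum (f := fun i => |f i x|) (fun i _ => abs_nonneg _)
      (Finset.mem_univ i)).trans (by simp [s])
  have hsmeas : AEMeasurable s μ := aemeasurable_const.add
    (Finset.aemeasurable_fun_sum _ fun i _ => (f i).aemeasurable.abs)
  have hφmeas : AEMeasurable (fun x => √(φ x)) μ := hmeas.sqrt.aemeasurable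
  have hroot : MemLp (fun x => √(φ x)) 2 μ := by
    rw [memLp_two_iff_integrable_sq hφmeas.aestronglyMeasurable]
    simpa only [Real.sq_sqrt (hpos _).le] using hint
  have hmem : ∀ i, MemLp (fun x => f i x * (s x)⁻¹ * √(φ x)) 2 μ := fun i => by
    refine hroot.mono (((f i).aemeasurable.mul hsmeas.inv).mul hφmeas).aestronglyMeasurable
      (Eventually.of_forall fun x => ?_)
    rw [norm_mul, norm_mul, norm_inv, Real.norm_eq_abs, Real.norm_eq_abs (s x),
      abs_of_pos (hs x), ← div_eq_mul_inv]
    exact mul_le_of_le_one_left (norm_nonneg _) ((div_le_one (hs x)).2 (hfs i x))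
  have hψ : AEStronglyMeasurable (fun x => s x * (√(φ x))⁻¹) μ :=
    (hsmeas.mul hφmeas.inv).aestronglyMeasurable
  refine ⟨AEEqFun.mk _ hψ, fun i => (hmem i).toLp _, ?_, fun i => ?_⟩
  · filter_upwards [AEEqFun.coeFn_mk _ hψ] with x hx
    rw [hx]
    exact mul_pos (hs x) (inv_pos.2 (Real.sqrt_pos.2 (hpos x)))
  · refine AEEqFun.ext ?_
    filter_upwards [AEEqFun.coeFn_mk _ hψ, (hmem i).coeFn_toLp,
      AEEqFun.coeFn_mul (AEEqFun.mk _ hψ) ((hmem i).toLp _ : X →ₘ[μ] ℝ)] with x h1 h2 h3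
    rw [h3, Pi.mul_apply, h1, h2]
    have := (hs x).ne'
    have := (Real.sqrt_pos.2 (hpos x)).ne'
    field_simp

/-- The form `u ↦ E(ψ u)` on `L²` for a form `E` on `L⁰`. -/
def weightedForm (E : (X →ₘ[μ] ℝ) → ℝ≥0∞) (ψ : X →ₘ[μ] ℝ) (u : Lp ℝ 2 μ) : ℝ≥0∞ :=
  E (ψ * (u : X →ₘ[μ] ℝ))

theorem mul_coe_smul (ψ : X →ₘ[μ] ℝ) (c : ℝ) (u : Lp ℝ 2 μ) :
    ψ * ((c • u : Lp ℝ 2 μ) : X →ₘ[μ] ℝ) = c • (ψ * (u : X →ₘ[μ] ℝ)) := by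
  refine AEEqFun.ext ?_
  filter_upwards [AEEqFun.coeFn_mul ψ ((c • u : Lp ℝ 2 μ) : X →ₘ[μ] ℝ), Lp.coeFn_smul c u,
    AEEqFun.coeFn_smul c (ψ * (u : X →ₘ[μ] ℝ)), AEEqFun.coeFn_mul ψ (u : X →ₘ[μ] ℝ)]
    with x h1 h2 h3 h4
  simp only [h1, h2, h3, h4, Pi.mul_apply, Pi.smul_apply, smul_eq_mul]
  ring

theorem mul_coe_add (ψ : X →ₘ[μ] ℝ) (u v : Lp ℝ 2 μ) :
    ψ * ((u + v : Lp ℝ 2 μ) : X →ₘ[μ] ℝ) = ψ * (u : X →ₘ[μ] ℝ) + ψ * (v : X →ₘ[μ] ℝ) := by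
  refine AEEqFun.ext ?_
  filter_upwards [AEEqFun.coeFn_mul ψ ((u + v : Lp ℝ 2 μ) : X →ₘ[μ] ℝ), Lp.coeFn_add u v,
    AEEqFun.coeFn_add (ψ * (u : X →ₘ[μ] ℝ)) (ψ * (v : X →ₘ[μ] ℝ)),
    AEEqFun.coeFn_mul ψ (u : X →ₘ[μ] ℝ), AEEqFun.coeFn_mul ψ (v : X →ₘ[μ] ℝ)] with x h1 h2 h3 h4 h5
  simp only [h1, h2, h3, h4, h5, Pi.mul_apply, Pi.add_apply]
  ring

theorem mul_coe_sub (ψ : X →ₘ[μ] ℝ) (u v : Lp ℝ 2 μ) :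
    ψ * ((u - v : Lp ℝ 2 μ) : X →ₘ[μ] ℝ) = ψ * (u : X →ₘ[μ] ℝ) - ψ * (v : X →ₘ[μ] ℝ) := by
  refine AEEqFun.ext ?_
  filter_upwards [AEEqFun.coeFn_mul ψ ((u - v : Lp ℝ 2 μ) : X →ₘ[μ] ℝ), Lp.coeFn_sub u v,
    AEEqFun.coeFn_sub (ψ * (u : X →ₘ[μ] ℝ)) (ψ * (v : X →ₘ[μ] ℝ)),
    AEEqFun.coeFn_mul ψ (u : X →ₘ[μ] ℝ), AEEqFun.coeFn_mul ψ (v : X →ₘ[μ] ℝ)] with x h1 h2 h3 h4 h5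
  simp only [h1, h2, h3, h4, h5, Pi.mul_apply, Pi.sub_apply]
  ring

theorem IsQuadForm.weightedForm {E : (X →ₘ[μ] ℝ) → ℝ≥0∞} (hE : IsQuadForm E) (ψ : X →ₘ[μ] ℝ) :
    IsQuadForm (weightedForm E ψ) where
  smul c u := by simp only [_root_.weightedForm, mul_coe_smul, hE.smul]
  parallelogram u v := by
    simp only [_root_.weightedForm, mul_coe_add, mul_coe_sub, hE.parallelogram]

theorem polarForm_weightedForm (E : (X →ₘ[μ] ℝ) → ℝ≥0∞) (ψ : X →ₘ[μ] ℝ) (u v : Lp ℝ 2 μ) :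
    polarForm (weightedForm E ψ) u v = polarForm E (ψ * (u : X →ₘ[μ] ℝ)) (ψ * (v : X →ₘ[μ] ℝ)) := by
  simp only [polarForm, weightedForm, mul_coe_add, mul_coe_sub]

theorem mul_coe_abs_eq_abs_mul {ψ : X →ₘ[μ] ℝ} (hψ : ∀ᵐ x ∂μ, 0 < ψ x) (u : Lp ℝ 2 μ) :
    ψ * ((|u| : Lp ℝ 2 μ) : X →ₘ[μ] ℝ) = |ψ * (u : X →ₘ[μ] ℝ)| := by
  refine AEEqFun.ext ?_
  filter_upwards [hψ, AEEqFun.coeFn_mul ψ ((|u| : Lp ℝ 2 μ) : X →ₘ[μ] ℝ), Lp.coeFn_abs u,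
    AEEqFun.coeFn_abs (ψ * (u : X →ₘ[μ] ℝ)), AEEqFun.coeFn_mul ψ (u : X →ₘ[μ] ℝ)]
    with x h0 h1 h2 h3 h4
  rw [h1, Pi.mul_apply, h2, h3, h4, Pi.mul_apply, abs_mul, abs_of_pos h0]

theorem IsQuadForm.weightedForm_le_of_tendsto [SigmaFinite μ] {q : Lp ℝ 2 μ → ℝ≥0∞}
    (hq : IsQuadForm q) (ψ : X →ₘ[μ] ℝ) {u : ℕ → Lp ℝ 2 μ} {v : Lp ℝ 2 μ} {C : ℝ≥0∞}
    (huv : Tendsto u atTop (𝓝 v)) (hu : ∀ n, _root_.weightedForm (extendedForm q) ψ (u n) ≤ C) :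
    _root_.weightedForm (extendedForm q) ψ v ≤ C := by
  obtain ⟨ns, -, hae⟩ := (tendstoInMeasure_of_tendsto_Lp huv).exists_seq_tendsto_ae
  refine hq.extendedForm_le_of_ae_tendsto (fun n => hu (ns n)) ?_
  filter_upwards [hae, AEEqFun.coeFn_mul ψ (v : X →ₘ[μ] ℝ),
    ae_all_iff.2 fun n => AEEqFun.coeFn_mul ψ (u n : X →ₘ[μ] ℝ)] with x hx h1 h2
  simpa only [h1, h2, Pi.mul_apply] using hx.const_mul (ψ x)

end Weights

/-! ### The Hardy inequality for the extended form -/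

theorem mainTheorem10 {X : Type*} [MeasurableSpace X] (μ : Measure X) [SigmaFinite μ]
    (q : Lp ℝ 2 μ → ℝ≥0∞) (hq : IsQuadForm q) (hclosed : IsClosedForm q)
    (hBD : FirstBeurlingDeny q)
    (h f : X →ₘ[μ] ℝ) (h_nonneg : 0 ≤ h)
    (hh : h ∈ formDomain (extendedForm q)) (hf : f ∈ formDomain (extendedForm q))
    (hhf : h * f ∈ formDomain (extendedForm q))
    (hhf2 : h * f ^ 2 ∈ formDomain (extendedForm q)) :
    (extendedForm q (h * f)).toReal ≥ polarForm (extendedForm q) (h * f ^ 2) h := by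
  obtain ⟨ψ, a, hψ, ha⟩ := exists_pos_weight_L2 (fun i : Fin 3 => h * f ^ (i : ℕ))
  have ha0 : ψ * (a 0 : X →ₘ[μ] ℝ) = h := by simpa using ha 0
  have ha1 : ψ * (a 1 : X →ₘ[μ] ℝ) = h * f := by simpa using ha 1
  have ha2 : ψ * (a 2 : X →ₘ[μ] ℝ) = h * f ^ 2 := by simpa using ha 2
  have hE := (isQuadForm_extendedForm hq).weightedForm ψ
  obtain ⟨B, hpolar, hsymm, hdiag⟩ := hE.exists_bilinForm
  have hnn : ∀ u, 0 ≤ B u u := fun u => by rw [hdiag]; exact ENNReal.toReal_nonneg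
  have hlsc : IsLscForm B := fun u v C huv hu => by
    have hC : 0 ≤ C := (hnn (u 0)).trans (hu 0)
    have hle : weightedForm (extendedForm q) ψ v ≤ ENNReal.ofReal C :=
      hq.weightedForm_le_of_tendsto ψ huv fun n =>
        (ENNReal.le_ofReal_iff_toReal_le (u n).2.ne hC).2 (hdiag (u n) ▸ hu n)
    refine ⟨hle.trans_lt ENNReal.ofReal_lt_top, ?_⟩
    rw [hdiag]
    exact ENNReal.toReal_le_of_le_ofReal hC hle
  have habs : ∀ u : hE.domain, ∃ hu : |(u : Lp ℝ 2 μ)| ∈ hE.domain,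
      B ⟨_, hu⟩ ⟨_, hu⟩ ≤ B u u := fun u => by
    have hle : weightedForm (extendedForm q) ψ |(u : Lp ℝ 2 μ)| ≤
        weightedForm (extendedForm q) ψ u := by
      rw [weightedForm, mul_coe_abs_eq_abs_mul hψ]
      exact extendedForm_abs_le hq hBD _
    refine ⟨hle.trans_lt u.2, ?_⟩
    rw [hdiag, hdiag]
    exact ENNReal.toReal_mono u.2.ne hle
  have hmem : ∀ {u : Lp ℝ 2 μ} {g : X →ₘ[μ] ℝ}, ψ * (u : X →ₘ[μ] ℝ) = g →
      g ∈ formDomain (extendedForm q) → u ∈ hE.domain := fun hu hg => by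
    rw [hE.mem_domain, weightedForm, hu]
    exact hg
  -- Cancelling `ψ > 0` turns this into `a 0 ≥ 0`, `a 1 = a 0 · f` and `a 2 = a 0 · f²`, so the
  -- multiplier `F` is `f` itself.
  have hmul : ∀ᵐ x ∂μ, ∀ i : Fin 3, ψ x * a i x = h x * f x ^ (i : ℕ) := by
    refine ae_all_iff.2 fun i => ?_
    have hi : ⇑(ψ * (a i : X →ₘ[μ] ℝ)) =ᵐ[μ] ⇑(h * f ^ (i : ℕ)) := by rw [ha i]
    filter_upwards [hi, AEEqFun.coeFn_mul ψ (a i : X →ₘ[μ] ℝ), AEEqFun.coeFn_mul h (f ^ (i : ℕ)),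
      AEEqFun.coeFn_pow f (i : ℕ)] with x h1 h2 h3 h4
    rw [h2, h3, Pi.mul_apply, Pi.mul_apply, h4] at h1
    exact h1
  have key := bilinForm_le_of_mul_sq hsymm hnn hlsc habs ⟨a 0, hmem ha0 hh⟩ ⟨a 1, hmem ha1 hhf⟩
    ⟨a 2, hmem ha2 hhf2⟩ f
    (by
      rw [← Lp.coeFn_nonneg]
      filter_upwards [hmul, hψ, AEEqFun.coeFn_le.2 h_nonneg,
        AEEqFun.coeFn_zero (α := X) (μ := μ) (β := ℝ)] with x hx h0 h1 h2
      have h3 := hx 0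
      rw [h2] at h1
      simp only [Fin.val_zero, pow_zero, mul_one] at h3
      exact nonneg_of_mul_nonneg_right (h3 ▸ h1) h0)
    (by
      filter_upwards [hmul, hψ] with x hx h0
      have h3 := hx 0
      have h4 := hx 1
      simp only [Fin.val_zero, Fin.val_one, pow_zero, pow_one, mul_one] at h3 h4
      refine mul_left_cancel₀ h0.ne' ?_
      rw [h4, ← mul_assoc, h3])
    (by
      filter_upwards [hmul, hψ] with x hx h0
      have h3 := hx 0
      have h4 := hx 2
      simp only [Fin.val_zero, Fin.val_two, pow_zero, mul_one] at h3 h4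
      refine mul_left_cancel₀ h0.ne' ?_
      rw [h4, ← mul_assoc, h3])
  rw [hpolar, hdiag, polarForm_weightedForm, weightedForm, ha0, ha1, ha2] at key
  exact key
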